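/- For an even integer $k \ge 4$ and $\tau$ in the upper half plane $\mathbb{H}$, let $$E_k(\tau) = \frac12 \sum_{\substack{c,d\in\mathbb{Z}\\ \gcd(c,d)=1}} (c\tau+d)^{-k}$$ be the normalized Eisenstein series of weight $k$ for $\mathrm{SL}_2(\mathbb{Z})$, and let $$\mathcal{F} = \{\tau\in\mathbb{H} : |\tau|>1,\ 0<\operatorname{Re}\tau<\tfrac12\} \cup \{\tau\in\mathbb{H} : |\tau|\ge 1,\ -\tfrac12\le \operatorname{Re}\tau\le 0\}$$ be the standard fundamental domain. If $k$ and $l$ are even integers with $k > l \ge 10$, then every zero of $E_k(\tau)E_l(\tau)+E_{k+l}(\tau)$ in $\mathcal{F}$ lies on the arc $\mathcal{A} = \{e^{i\theta} : \pi/2\le\theta\le 2\pi/3\}$. -/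

import Mathlib

open UpperHalfPlane

/-- The standard (strict, half-open) fundamental domain for the action of `SL(2, ℤ)` on the upper
half plane: the part `|τ| > 1`, `0 < Re τ < 1/2` together with the part `|τ| ≥ 1`,
`-1/2 ≤ Re τ ≤ 0`. -/
def stdFundamentalDomain : Set ℍ :=
  {τ | 1 < ‖(τ : ℂ)‖ ∧ 0 < τ.re ∧ τ.re < 1 / 2} ∪
    {τ | 1 ≤ ‖(τ : ℂ)‖ ∧ -(1 / 2) ≤ τ.re ∧ τ.re ≤ 0}

/-- The arc `{e^{iθ} : π/2 ≤ θ ≤ 2π/3}` of the unit circle. -/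
def lowerArc : Set ℂ :=
  {z | ∃ θ : ℝ, Real.pi / 2 ≤ θ ∧ θ ≤ 2 * Real.pi / 3 ∧ z = Complex.exp (Complex.I * θ)}

/-!
Let `f = E_k E_l + E_{k+l}`, and write its weight as `12 n + 4 a + 6 b` with `a ≤ 2` and `b ≤ 1`.
Division by `Δ` shows that `f = E₄ ^ a * E₆ ^ b * Δ ^ n * P(j)`, where `j = E₄ ^ 3 / Δ` and `P` is
a polynomial of degree at most `n`, which is nonzero because `f` has constant term `2`
(`exists_polynomial_jFun`). So it is enough to find `n` zeros of `f` on the open arc and to know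
that the values of `j` at these zeros are distinct from each other and from the value of `j` at a
point of the fundamental domain with `|τ| > 1`. This replaces the valence formula.

*Zeros on the arc.* The function `exp(i (k + l) θ / 2) f(exp(iθ))` is real. The terms of the
Eisenstein series with `max(|c|, |d|) ≤ 1` approximate it well (`norm_E_sub_le`,
`abs_arcE_sub_le`), with main term `4 cos ((k + l) θ / 2) + 2 cos ((k - l) θ / 2)` away from
`θ = 2π/3`. Hence it has the sign of the first cosine at the points where this cosine is `±1`
(`sign_arcE`); near `2π/3`, the terms `(2 cos (θ / 2)) ^ (-k)` and `(2 cos (θ / 2)) ^ (-l)` are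
not small and enter the estimate. There are `n + 1` such points in `[π/2, 2π/3]`, and `n` zeros
between them (`exists_zeros_on_arc`).

*Separation by `j`.* If `j z = j w`, the factorization above for the forms `E_{12 N + 4}` shows
that their values at `z` and `w` agree up to a factor `y * x ^ N`. On the other hand
`E_k(z) = 1 + z⁻ᵏ + o(1)` as `k → ∞` for the points in question (`IsGeneric.tendsto_E_sub`).
Linear independence of geometric sequences then determines `z` from `w`
(`IsGeneric.pow_eq_or_mul_pow_eq_one`), and likewise shows that `E₄` and `E₆` do not vanish at
these points.
-/

/-! ### Level one forms as polynomials in `j` -/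

open ModularForm MatrixGroups EisensteinSeries in
lemma exists_modularForm_E₄_pow_mul_E₆_pow (i j : ℕ) (k : ℤ) (hk : k = 4 * i + 6 * j) :
    ∃ g : ModularForm 𝒮ℒ k, (∀ z, g z = E₄ z ^ i * E₆ z ^ j) ∧ (qExpansion 1 g).coeff 0 = 1 := by
  refine ⟨ModularForm.mcast (by rw [hk]; ring) ((E₄.pow i).mul (E₆.pow j)), fun z ↦ ?_, ?_⟩
  · change ((E₄.pow i).mul (E₆.pow j)) z = _
    simp [ModularForm.coe_mul, ModularForm.coe_pow]
  rw [ModularForm.qExpansion_mcast, ModularForm.qExpansion_mul one_pos one_mem_strictPeriods_SL,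
    ModularForm.qExpansion_pow one_pos one_mem_strictPeriods_SL,
    ModularForm.qExpansion_pow one_pos one_mem_strictPeriods_SL]
  have h4 := E_qExpansion_coeff_zero (k := 4) (by norm_num) ⟨2, rfl⟩
  have h6 := E_qExpansion_coeff_zero (k := 6) (by norm_num) ⟨3, rfl⟩
  simp only [PowerSeries.coeff_zero_eq_constantCoeff, map_mul, map_pow] at *
  simp [h4, h6]

open ModularForm MatrixGroups EisensteinSeries in
/-- A form with constant term `1` generates the forms of its weight modulo cusp forms, and a cusp
form is `Δ` times a form of weight `k - 12`. -/
lemma exists_eq_smul_add_discriminant_mul {k : ℤ} (f g : ModularForm 𝒮ℒ k)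
    (hg : (qExpansion 1 g).coeff 0 = 1) :
    ∃ h : ModularForm 𝒮ℒ (k - 12), ∀ z,
      f z = (qExpansion 1 f).coeff 0 * g z + discriminant z * h z := by
  have h0 := (isCuspForm_iff_coeffZero_eq_zero _).mp (sub_smul_isCuspForm f g hg)
  refine ⟨CuspForm.discriminantEquiv (toCuspForm _ h0), fun z ↦ ?_⟩
  rw [discriminant_mul_discriminantEquiv_apply]
  simp

/-- The modular function `j = E₄³ / Δ`. -/
noncomputable def jFun (z : ℍ) : ℂ := ModularForm.E₄ z ^ 3 / ModularForm.discriminant z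

open ModularForm MatrixGroups EisensteinSeries Polynomial in
/-- Every level one form of weight `12 n + 4 a + 6 b`, with `a ≤ 2` and `b ≤ 1`, is
`E₄ ^ a * E₆ ^ b * Δ ^ n * P(j)` for a polynomial `P` of degree at most `n` whose coefficient in
degree `n` is the constant term of the form. Every even weight `k ≥ 0` except `2` is of this
shape. -/
theorem exists_polynomial_jFun {a b : ℕ} (ha : a ≤ 2) (hb : b ≤ 1) (n : ℕ) {k : ℤ}
    (hk : k = 12 * n + 4 * a + 6 * b) (f : ModularForm 𝒮ℒ k) :
    ∃ P : ℂ[X], P.natDegree ≤ n ∧ P.coeff n = (qExpansion 1 f).coeff 0 ∧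
      ∀ z, f z = E₄ z ^ a * E₆ z ^ b * discriminant z ^ n * P.eval (jFun z) := by
  induction n generalizing k f with
  | zero =>
    obtain ⟨g, hg, hg0⟩ := exists_modularForm_E₄_pow_mul_E₆_pow a b k (by simpa using hk)
    obtain ⟨h, hh⟩ := exists_eq_smul_add_discriminant_mul f g hg0
    have h0 : h = 0 := by
      rcases lt_or_ge k 12 with hk' | hk'
      · exact rank_zero_iff_forall_zero.mp (levelOne_neg_weight_rank_zero (by lia)) h
      -- The remaining case is `a = 2`, `b = 1`, where the quotient by `Δ` has weight two.
      · obtain rfl : k = 14 := by lia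
        exact rank_zero_iff_forall_zero.mp levelOne_weight_two_rank_zero h
    refine ⟨C ((qExpansion 1 f).coeff 0), by simp, by simp, fun z ↦ ?_⟩
    simp [hh, hg, h0]
    ring
  | succ n ih =>
    obtain ⟨g, hg, hg0⟩ := exists_modularForm_E₄_pow_mul_E₆_pow (a + 3 * (n + 1)) b k
      (by rw [hk]; push_cast; ring)
    obtain ⟨h, hh⟩ := exists_eq_smul_add_discriminant_mul f g hg0
    obtain ⟨P, hP, -, hPz⟩ := ih (by rw [hk]; push_cast; ring) h
    refine ⟨C ((qExpansion 1 f).coeff 0) * X ^ (n + 1) + P, ?_, ?_, fun z ↦ ?_⟩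
    · compute_degree!
      lia
    · simp [coeff_eq_zero_of_natDegree_lt (show P.natDegree < n + 1 by lia)]
    · have hj : E₄ z ^ 3 = jFun z * discriminant z :=
        (div_mul_cancel₀ _ (discriminant_ne_zero z)).symm
      rw [hh, hg, hPz, pow_add, pow_mul, hj]
      simp only [eval_add, eval_mul, eval_C, eval_pow, eval_X]
      ring

/-! ### Approximation of Eisenstein series on the fundamental domain -/

/-- On `|z| ≥ 1`, `|Re z| ≤ 1/2` one has `|c z + d|² ≥ c² - |c d| + d² ≥ 3/4 max(|c|, |d|)²`. -/
lemma three_quarters_mul_max_sq_le_normSq {z : ℍ} (hz : 1 ≤ ‖(z : ℂ)‖) (hre : |z.re| ≤ 1 / 2)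
    (c d : ℤ) : 3 / 4 * (max c.natAbs d.natAbs : ℕ) ^ 2 ≤ ‖(c : ℂ) * z + d‖ ^ 2 := by
  have hz2 : 1 ≤ z.re ^ 2 + z.im ^ 2 := by
    have h := Complex.sq_norm (z : ℂ)
    rw [Complex.normSq_apply] at h
    simp only [coe_re, coe_im] at h
    nlinarith
  have key : (c : ℝ) ^ 2 - |(c : ℝ)| * |(d : ℝ)| + (d : ℝ) ^ 2 ≤ ‖(c : ℂ) * z + d‖ ^ 2 := by
    have h : ‖(c : ℂ) * z + d‖ ^ 2
        = c ^ 2 * (z.re ^ 2 + z.im ^ 2) + 2 * (c * d * z.re) + d ^ 2 := by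
      rw [Complex.sq_norm, Complex.normSq_apply]
      simp
      ring
    have h2 : |(c : ℝ) * d * z.re| ≤ |(c : ℝ)| * |(d : ℝ)| * (1 / 2) := by
      rw [abs_mul, abs_mul]
      gcongr
    have h3 := neg_abs_le ((c : ℝ) * d * z.re)
    rw [h]
    nlinarith [sq_nonneg (c : ℝ)]
  refine le_trans ?_ key
  have hc : (c.natAbs : ℝ) = |(c : ℝ)| := by simp [Nat.cast_natAbs]
  have hd : (d.natAbs : ℝ) = |(d : ℝ)| := by simp [Nat.cast_natAbs]
  rw [← sq_abs (c : ℝ), ← sq_abs (d : ℝ), Nat.cast_max, hc, hd]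
  rcases max_cases |(c : ℝ)| |(d : ℝ)| with ⟨h, -⟩ | ⟨h, -⟩ <;> rw [h]
  · nlinarith [sq_nonneg (|(c : ℝ)| - 2 * |(d : ℝ)|)]
  · nlinarith [sq_nonneg (|(d : ℝ)| - 2 * |(c : ℝ)|)]

lemma sum_Ico_two_inv_cube_le (N : ℕ) : ∑ n ∈ Finset.Ico 2 N, ((n : ℝ) ^ 3)⁻¹ ≤ 1 / 4 := by
  have h (m : ℕ) : ∑ n ∈ Finset.Ico 2 (m + 2), ((n : ℝ) ^ 3)⁻¹
      ≤ 1 / 4 - 1 / (2 * (m + 1) * (m + 2)) := by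
    -- `n⁻³ ≤ 1 / ((n - 1) n (n + 1))`, whose sum telescopes.
    induction m with
    | zero => simp; norm_num
    | succ m ih =>
      rw [show m + 1 + 2 = (m + 2) + 1 by ring, Finset.sum_Ico_succ_top (by lia)]
      refine (add_le_add_left ih _).trans ?_
      push_cast
      have : ((m + 2 : ℝ) ^ 3)⁻¹ ≤ 1 / ((m + 1) * (m + 2) * (m + 3)) := by
        rw [← one_div]
        apply one_div_le_one_div_of_le (by positivity)
        ring_nf
        nlinarith [(Nat.cast_nonneg m : (0 : ℝ) ≤ m)]
      have h2 : (1 : ℝ) / (2 * (m + 1) * (m + 2)) - 1 / (2 * (m + 1 + 1) * (m + 1 + 2))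
          = 1 / ((m + 1) * (m + 2) * (m + 3)) := by
        have h1 : (m + 1 : ℝ) ≠ 0 := by positivity
        have h2 : (m + 2 : ℝ) ≠ 0 := by positivity
        have h3 : (m + 3 : ℝ) ≠ 0 := by positivity
        have h4 : (m + 1 + 1 : ℝ) ≠ 0 := by positivity
        have h5 : (m + 1 + 2 : ℝ) ≠ 0 := by positivity
        field_simp
        ring
      linarith
  rcases le_or_gt 2 N with hN | hN
  · obtain ⟨m, rfl⟩ := Nat.exists_eq_add_of_le' hN
    refine (h m).trans ?_
    have : (0 : ℝ) ≤ 1 / (2 * (m + 1) * (m + 2)) := by positivity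
    linarith
  · rw [Finset.Ico_eq_empty (by lia)]
    norm_num

/-- There are `8 n` pairs of integers with `max(|c|, |d|) = n`, so this sum is at most
`∑_{n ≥ 2} 8 n (3 n² / 4) ^ (-h)`. -/
lemma sum_inv_max_pow_le {h : ℕ} (hh : 5 ≤ h) (s : Finset (ℤ × ℤ))
    (hs : ∀ p ∈ s, 2 ≤ max p.1.natAbs p.2.natAbs) :
    ∑ p ∈ s, ((3 / 4 * (max p.1.natAbs p.2.natAbs : ℕ) ^ 2 : ℝ) ^ h)⁻¹
      ≤ 2 / 15 * (1 / 3) ^ (h - 5) := by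
  obtain ⟨t, rfl⟩ := Nat.exists_eq_add_of_le hh
  let M : ℤ × ℤ → ℕ := fun p ↦ max p.1.natAbs p.2.natAbs
  have hM (p) (hp : p ∈ s) : M p ∈ Finset.Ico 2 (s.sup M + 1) := by
    exact Finset.mem_Ico.mpr ⟨hs p hp, Nat.lt_succ_of_le <| Finset.le_sup (f := M) hp⟩
  rw [← Finset.sum_fiberwise_of_maps_to hM]
  have hfib (n) (hn : n ∈ Finset.Ico 2 (s.sup M + 1)) :
      ∑ p ∈ s with M p = n, ((3 / 4 * (max p.1.natAbs p.2.natAbs : ℕ) ^ 2 : ℝ) ^ (5 + t))⁻¹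
        ≤ (8 * (4 / 3) ^ 5 / 2 ^ 6 * (1 / 3) ^ t) * ((n : ℝ) ^ 3)⁻¹ := by
    have hn2 : 2 ≤ n := (Finset.mem_Ico.mp hn).1
    have hnR : (2 : ℝ) ≤ n := by exact_mod_cast hn2
    have hcard : (s.filter (M · = n)).card ≤ 8 * n := by
      rw [← Int.card_box (by lia : n ≠ 0)]
      refine Finset.card_le_card fun p hp ↦ ?_
      rw [Int.mem_box]
      exact (Finset.mem_filter.mp hp).2
    calc _ = ∑ p ∈ s with M p = n, ((3 / 4 * (n : ℝ) ^ 2) ^ (5 + t))⁻¹ := by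
          refine Finset.sum_congr rfl fun p hp ↦ ?_
          rw [← (Finset.mem_filter.mp hp).2]
      _ = ((s.filter (M · = n)).card : ℝ) * ((3 / 4 * (n : ℝ) ^ 2) ^ (5 + t))⁻¹ := by simp
      _ ≤ (8 * n) * (((3 / 4 * (n : ℝ) ^ 2) ^ 5)⁻¹ * (3 ^ t)⁻¹) := by
          rw [pow_add, mul_inv]
          gcongr
          · exact_mod_cast hcard
          · nlinarith
      _ = (8 * (4 / 3) ^ 5 * (1 / 3) ^ t) * ((n : ℝ) ^ 3)⁻¹ * ((n : ℝ) ^ 6)⁻¹ := by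
          have : (n : ℝ) ≠ 0 := by positivity
          rw [one_div, inv_pow]
          field_simp
      _ ≤ (8 * (4 / 3) ^ 5 * (1 / 3) ^ t) * ((n : ℝ) ^ 3)⁻¹ * (2 ^ 6)⁻¹ := by gcongr
      _ = _ := by ring
  refine (Finset.sum_le_sum hfib).trans ?_
  rw [← Finset.mul_sum]
  have := sum_Ico_two_inv_cube_le (s.sup M + 1)
  calc _ ≤ (8 * (4 / 3) ^ 5 / 2 ^ 6 * (1 / 3) ^ t) * (1 / 4 : ℝ) := by gcongr
    _ = (8 * (4 / 3) ^ 5 / 2 ^ 6 * (1 / 4)) * (1 / 3) ^ t := by ring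
    _ ≤ _ := by
      rw [Nat.add_sub_cancel_left]
      gcongr
      norm_num

/-- The summand `(c z + d)⁻ᵏ` of the weight `k` Eisenstein series, extended by zero from coprime
pairs to all pairs `p = (c, d)` of integers. -/
noncomputable def coprimeSummand (k : ℕ) (z : ℂ) (p : ℤ × ℤ) : ℂ :=
  if Int.gcd p.1 p.2 = 1 then ((p.1 * z + p.2) ^ k)⁻¹ else 0

open ModularForm EisensteinSeries in
lemma hasSum_coprimeSummand {k : ℕ} (hk : 3 ≤ k) (z : ℍ) :
    HasSum (coprimeSummand k z) (2 * E hk z) := by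
  have hsum : Summable (fun v : Fin 2 → ℤ ↦ eisSummand k v z) :=
    (summable_norm_eisSummand (mod_cast hk) z).of_norm
  have hE : E hk z = 1 / 2 * ∑' v : gammaSet 1 1 0, eisSummand k v z := rfl
  have h2 : 2 * E hk z = ∑' v : gammaSet 1 1 0, eisSummand k v z := by rw [hE]; ring
  rw [h2]
  have h3 : HasSum ((gammaSet 1 1 0).indicator fun v ↦ eisSummand k v z)
      (∑' v : gammaSet 1 1 0, eisSummand k v z) :=
    hasSum_subtype_iff_indicator.mp (hsum.subtype (gammaSet 1 1 0)).hasSum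
  rw [← (finTwoArrowEquiv ℤ).symm.hasSum_iff] at h3
  convert h3 using 1
  ext p
  classical
  rw [Function.comp_apply, Set.indicator_apply, gammaSet_one_mem_iff]
  simp [coprimeSummand, eisSummand]

open ModularForm in
/-- Approximation of `E_k` by its terms with `max(|c|, |d|) = 1`, uniformly on `|z| ≥ 1`,
`|Re z| ≤ 1/2`. -/
theorem norm_E_sub_le {k h : ℕ} (hk : 3 ≤ k) (hkh : k = 2 * h) (hh : 5 ≤ h) {z : ℍ}
    (hz : 1 ≤ ‖(z : ℂ)‖) (hre : |z.re| ≤ 1 / 2) :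
    ‖E hk z - (1 + ((z : ℂ) ^ k)⁻¹ + (((z : ℂ) + 1) ^ k)⁻¹ + (((z : ℂ) - 1) ^ k)⁻¹)‖
      ≤ 1 / 15 * (1 / 3) ^ (h - 5) := by
  have hS := hasSum_coprimeSummand hk z
  let B : Finset (ℤ × ℤ) := {-1, 0, 1} ×ˢ {-1, 0, 1}
  have hev : Even k := ⟨h, by lia⟩
  have hB : ∑ p ∈ B, coprimeSummand k z p
      = 2 * (1 + ((z : ℂ) ^ k)⁻¹ + (((z : ℂ) + 1) ^ k)⁻¹ + (((z : ℂ) - 1) ^ k)⁻¹) := by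
    have e1 : (-(z : ℂ) + 1) ^ k = ((z : ℂ) - 1) ^ k := by
      rw [← hev.neg_pow]; ring
    have e2 : (-(z : ℂ) - 1) ^ k = ((z : ℂ) + 1) ^ k := by
      rw [← hev.neg_pow]; ring
    simp only [B, Finset.sum_product]
    have e3 : (0 : ℂ) ^ k = 0 := zero_pow (by lia)
    simp [coprimeSummand, e1, e2, hev.neg_pow, ← sub_eq_add_neg]
    ring
  have htail := hS.summable.sum_add_tsum_subtype_compl B
  rw [hS.tsum_eq, hB] at htail
  have hbound : ‖∑' p : {p // p ∉ B}, coprimeSummand k z p‖ ≤ 2 / 15 * (1 / 3) ^ (h - 5) := by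
    have hterm (p : ℤ × ℤ) (hp : p ∉ B) : 2 ≤ max p.1.natAbs p.2.natAbs ∧
        ‖coprimeSummand k z p‖ ≤ ((3 / 4 * (max p.1.natAbs p.2.natAbs : ℕ) ^ 2 : ℝ) ^ h)⁻¹ := by
      have h2 : 2 ≤ max p.1.natAbs p.2.natAbs := by
        simp only [B, Finset.mem_product, Finset.mem_insert, Finset.mem_singleton] at hp
        lia
      refine ⟨h2, ?_⟩
      rw [coprimeSummand]
      split_ifs
      · rw [norm_inv, norm_pow, hkh, pow_mul]
        have : (0 : ℝ) < (max p.1.natAbs p.2.natAbs : ℕ) := by exact_mod_cast by lia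
        gcongr
        exact three_quarters_mul_max_sq_le_normSq hz hre p.1 p.2
      · simp only [norm_zero]; positivity
    have hfin (s : Finset {p // p ∉ B}) :
        ∑ p ∈ s, ‖coprimeSummand k z p‖ ≤ 2 / 15 * (1 / 3) ^ (h - 5) := by
      refine le_trans ?_ (sum_inv_max_pow_le hh (s.map (Function.Embedding.subtype _)) ?_)
      · rw [Finset.sum_map]
        exact Finset.sum_le_sum fun p _ ↦ (hterm p p.2).2
      · intro p hp
        obtain ⟨q, -, rfl⟩ := Finset.mem_map.mp hp
        exact (hterm q q.2).1
    have hsn := summable_of_sum_le (fun _ ↦ norm_nonneg _) hfin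
    exact (norm_tsum_le_tsum_norm hsn).trans (hsn.tsum_le_of_sum_le hfin)
  rw [show E hk z - (1 + ((z : ℂ) ^ k)⁻¹ + (((z : ℂ) + 1) ^ k)⁻¹ + (((z : ℂ) - 1) ^ k)⁻¹)
    = 1 / 2 * ∑' p : {p // p ∉ B}, coprimeSummand k z p by linear_combination -1 / 2 * htail,
    norm_mul]
  norm_num at hbound ⊢
  linarith

open ModularForm ComplexConjugate in
/-- On the unit circle, `z̄ = z⁻¹`, so complex conjugation of the series amounts to the exchange
of `c` and `d`, up to the factor `z ^ k`. -/
lemma conj_E_eq {k : ℕ} (hk : 3 ≤ k) {z : ℍ} (hz : ‖(z : ℂ)‖ = 1) :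
    conj (E hk z) = (z : ℂ) ^ k * E hk z := by
  have hS := hasSum_coprimeSummand hk z
  have h1 := Complex.hasSum_conj'.mpr hS
  have h2 := ((Equiv.prodComm ℤ ℤ).hasSum_iff.mpr hS).mul_left ((z : ℂ) ^ k)
  have h0 : (z : ℂ) ≠ 0 := ne_zero z
  have hzz : (z : ℂ) * conj (z : ℂ) = 1 := by rw [Complex.mul_conj']; simp [hz]
  have h3 : (fun p ↦ conj (coprimeSummand k z p)) =
      fun p ↦ (z : ℂ) ^ k * (coprimeSummand k z ∘ Equiv.prodComm ℤ ℤ) p := by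
    ext p
    simp only [coprimeSummand, Function.comp, Equiv.prodComm_apply, Prod.fst_swap, Prod.snd_swap,
      Int.gcd_comm p.2]
    split_ifs
    · have : (p.2 * (z : ℂ) + p.1) = z * (p.1 * conj (z : ℂ) + p.2) := by
        linear_combination -(p.1 : ℂ) * hzz
      rw [this, mul_pow, mul_inv, mul_inv_cancel_left₀ (pow_ne_zero _ h0)]
      simp
    · simp
  rw [h3] at h1
  have := h1.unique h2
  simp only [map_mul, map_ofNat] at this
  linear_combination this / 2

/-! ### Separation of points by `j` -/

open Filter Topology in
lemma tendsto_shift_sub_mul {A : ℕ → ℂ} (hA : Tendsto A atTop (𝓝 0)) (r : ℂ) :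
    Tendsto (fun N ↦ A (N + 1) - r * A N) atTop (𝓝 0) := by
  simpa using (hA.comp (tendsto_add_atTop_nat 1)).sub (hA.const_mul r)

open Filter Topology in
/-- If a linear combination of four geometric sequences tends to zero, then its coefficient
vanishes at a ratio of norm at least one which differs from the other three: the operators
`A ↦ A (· + 1) - r * A` remove the other three sequences. -/
lemma coeff_eq_zero_of_tendsto_geometric {c₁ c₂ c₃ c₄ r₁ r₂ r₃ r₄ : ℂ} (hr : 1 ≤ ‖r₁‖)
    (h₂ : r₂ ≠ r₁) (h₃ : r₃ ≠ r₁) (h₄ : r₄ ≠ r₁)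
    (h : Tendsto (fun N : ℕ ↦ c₁ * r₁ ^ N + c₂ * r₂ ^ N + c₃ * r₃ ^ N + c₄ * r₄ ^ N) atTop (𝓝 0)) :
    c₁ = 0 := by
  have h' := (tendsto_shift_sub_mul (tendsto_shift_sub_mul (tendsto_shift_sub_mul h r₂) r₃) r₄).norm
  have e (N : ℕ) : ‖c₁ * ((r₁ - r₂) * (r₁ - r₃) * (r₁ - r₄))‖ ≤
      ‖c₁ * r₁ ^ (N + 1 + 1 + 1) + c₂ * r₂ ^ (N + 1 + 1 + 1) + c₃ * r₃ ^ (N + 1 + 1 + 1) +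
        c₄ * r₄ ^ (N + 1 + 1 + 1) - r₂ * (c₁ * r₁ ^ (N + 1 + 1) + c₂ * r₂ ^ (N + 1 + 1) +
        c₃ * r₃ ^ (N + 1 + 1) + c₄ * r₄ ^ (N + 1 + 1)) - r₃ * (c₁ * r₁ ^ (N + 1 + 1) +
        c₂ * r₂ ^ (N + 1 + 1) + c₃ * r₃ ^ (N + 1 + 1) + c₄ * r₄ ^ (N + 1 + 1) -
        r₂ * (c₁ * r₁ ^ (N + 1) + c₂ * r₂ ^ (N + 1) + c₃ * r₃ ^ (N + 1) + c₄ * r₄ ^ (N + 1))) -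
        r₄ * (c₁ * r₁ ^ (N + 1 + 1) + c₂ * r₂ ^ (N + 1 + 1) + c₃ * r₃ ^ (N + 1 + 1) +
        c₄ * r₄ ^ (N + 1 + 1) - r₂ * (c₁ * r₁ ^ (N + 1) + c₂ * r₂ ^ (N + 1) + c₃ * r₃ ^ (N + 1) +
        c₄ * r₄ ^ (N + 1)) - r₃ * (c₁ * r₁ ^ (N + 1) + c₂ * r₂ ^ (N + 1) + c₃ * r₃ ^ (N + 1) +
        c₄ * r₄ ^ (N + 1) - r₂ * (c₁ * r₁ ^ N + c₂ * r₂ ^ N + c₃ * r₃ ^ N + c₄ * r₄ ^ N)))‖ := by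
    calc _ = ‖c₁ * ((r₁ - r₂) * (r₁ - r₃) * (r₁ - r₄))‖ * 1 := (mul_one _).symm
      _ ≤ ‖c₁ * ((r₁ - r₂) * (r₁ - r₃) * (r₁ - r₄))‖ * ‖r₁ ^ N‖ := by
        rw [norm_pow]
        gcongr
        exact one_le_pow₀ hr
      _ = _ := by
        rw [← norm_mul]
        congr 1
        ring
  have h0 := ge_of_tendsto' h' e
  rw [norm_zero, norm_le_zero_iff] at h0
  simpa [sub_ne_zero.mpr h₂.symm, sub_ne_zero.mpr h₃.symm, sub_ne_zero.mpr h₄.symm] using h0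

open Filter Topology in
/-- Linear independence of geometric sequences, in the form which compares the asymptotics
`1 + b vᴺ` and `1 + a uᴺ` of the Eisenstein series of weight `12 N + 4` at two points with equal
`j`. -/
lemma eq_or_mul_eq_one_of_tendsto_geometric {a b y u v x : ℂ} (ha : a ≠ 0) (hb : b ≠ 0) (hy : y ≠ 0)
    (hu1 : u ≠ 1) (hv1 : v ≠ 1) (hu : ‖u‖ ≤ 1) (hx : ‖x‖ ≤ 1)
    (huv : ‖u‖ = 1 ∨ ‖v‖ = 1)
    (h : Tendsto (fun N : ℕ ↦ 1 + b * v ^ N - x ^ N * (y * (1 + a * u ^ N))) atTop (𝓝 0)) :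
    u = v ∨ (u * v = 1 ∧ a * b = 1) := by
  by_cases hx1 : x = 1
  · left
    by_contra hne
    rcases huv with hu' | hv'
    · have := coeff_eq_zero_of_tendsto_geometric (c₁ := -(y * a)) (c₂ := b) (c₃ := 1 - y) (c₄ := 0)
        (r₁ := u) (r₂ := v) (r₃ := 1) (r₄ := 1) hu'.ge (Ne.symm hne) hu1.symm hu1.symm
        (h.congr fun N ↦ by simp only [hx1, one_pow]; ring)
      simp [ha, hy] at this
    · have := coeff_eq_zero_of_tendsto_geometric (c₁ := b) (c₂ := -(y * a)) (c₃ := 1 - y) (c₄ := 0)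
        (r₁ := v) (r₂ := u) (r₃ := 1) (r₄ := 1) hv'.ge hne hv1.symm hv1.symm
        (h.congr fun N ↦ by simp only [hx1, one_pow]; ring)
      exact hb this
  · right
    have hxu : x * u = 1 := by
      by_contra hne
      have := coeff_eq_zero_of_tendsto_geometric (c₁ := 1) (c₂ := b) (c₃ := -y) (c₄ := -(y * a))
        (r₁ := 1) (r₂ := v) (r₃ := x) (r₄ := x * u) (by simp) hv1 hx1 hne
        (h.congr fun N ↦ by simp only [mul_pow, one_pow]; ring)
      simp at this
    have h' : Tendsto (fun N : ℕ ↦ 1 - y * a + b * v ^ N - y * x ^ N) atTop (𝓝 0) := by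
      refine h.congr fun N ↦ ?_
      have : x ^ N * u ^ N = 1 := by rw [← mul_pow, hxu, one_pow]
      linear_combination (-y * a) * this
    have hxn : ‖x‖ = 1 := by
      have : ‖x‖ * ‖u‖ = 1 := by rw [← norm_mul, hxu, norm_one]
      nlinarith [norm_nonneg x, norm_nonneg u]
    have hvx : v = x := by
      by_contra hne
      have := coeff_eq_zero_of_tendsto_geometric (c₁ := -y) (c₂ := b) (c₃ := 1 - y * a) (c₄ := 0)
        (r₁ := x) (r₂ := v) (r₃ := 1) (r₄ := 1) hxn.ge hne (Ne.symm hx1) (Ne.symm hx1)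
        (h'.congr fun N ↦ by simp only [one_pow]; ring)
      simp [hy] at this
    subst hvx
    have h1 := coeff_eq_zero_of_tendsto_geometric (c₁ := 1 - y * a) (c₂ := b - y)
        (c₃ := 0) (c₄ := 0) (r₁ := 1) (r₂ := v) (r₃ := v) (r₄ := v) (by simp) hv1 hv1 hv1
        (h'.congr fun N ↦ by simp only [one_pow]; ring)
    have h2 := coeff_eq_zero_of_tendsto_geometric (c₁ := b - y) (c₂ := 1 - y * a)
        (c₃ := 0) (c₄ := 0) (r₁ := v) (r₂ := 1) (r₃ := 1) (r₄ := 1) hxn.ge hv1.symm hv1.symm hv1.symm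
        (h'.congr fun N ↦ by simp only [one_pow]; ring)
    exact ⟨by rw [mul_comm]; exact hxu, by linear_combination -h1 + a * h2⟩

/-- The points at which `E_k(z)` is `1 + z⁻ᵏ` up to `o(1)` as `k → ∞`, and at which `1` and `z⁻ᵏ`,
with `k` running through a residue class modulo `12`, are geometric sequences with different
ratios. Inside the closed fundamental domain these are the points off the unit circle and the
points of the two open arcs between the elliptic points. -/
structure IsGeneric (z : ℍ) : Prop where
  one_le_norm : 1 ≤ ‖(z : ℂ)‖
  abs_re_le : |z.re| ≤ 1 / 2
  one_lt_norm_add_one : 1 < ‖(z : ℂ) + 1‖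
  one_lt_norm_sub_one : 1 < ‖(z : ℂ) - 1‖
  pow_ne_one : (z : ℂ) ^ 12 ≠ 1

namespace IsGeneric

lemma inv_pow_ne_one {z : ℍ} (hz : IsGeneric z) : ((z : ℂ) ^ 12)⁻¹ ≠ 1 := by
  simpa using hz.pow_ne_one

lemma norm_inv_pow_le_one {z : ℍ} (hz : IsGeneric z) : ‖((z : ℂ) ^ 12)⁻¹‖ ≤ 1 := by
  rw [norm_inv, norm_pow]
  exact inv_le_one_of_one_le₀ (one_le_pow₀ hz.one_le_norm)

open Filter Topology in
/-- `E_k(z) = 1 + z⁻ᵏ + o(1)` along the weights `k = 12 N + c`. -/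
theorem tendsto_E_sub {z : ℍ} (hz : IsGeneric z) {c : ℕ} (hc : Even c) (hc3 : 3 ≤ c) :
    Tendsto (fun N : ℕ ↦ ModularForm.E (show 3 ≤ 12 * N + c by lia) z -
      (1 + ((z : ℂ) ^ c)⁻¹ * ((z : ℂ) ^ 12)⁻¹ ^ N)) atTop (𝓝 0) := by
  obtain ⟨d, rfl⟩ := hc
  have hpow {w : ℂ} (hw : 1 < ‖w‖) :
      Tendsto (fun N : ℕ ↦ (w ^ (12 * N + (d + d)))⁻¹) atTop (𝓝 0) := by
    have h1 : ‖w⁻¹‖ < 1 := by rw [norm_inv]; exact inv_lt_one_of_one_lt₀ hw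
    refine ((tendsto_pow_atTop_nhds_zero_of_norm_lt_one h1).comp
      (tendsto_atTop_mono (fun N ↦ (by lia : N ≤ 12 * N + (d + d))) tendsto_id)).congr fun N ↦ ?_
    simp
  have herr : Tendsto (fun N : ℕ ↦ ModularForm.E (show 3 ≤ 12 * N + (d + d) by lia) z -
      (1 + ((z : ℂ) ^ (12 * N + (d + d)))⁻¹ + (((z : ℂ) + 1) ^ (12 * N + (d + d)))⁻¹ +
        (((z : ℂ) - 1) ^ (12 * N + (d + d)))⁻¹)) atTop (𝓝 0) := by
    have hlim : Tendsto (fun N : ℕ ↦ 1 / 15 * (1 / 3 : ℝ) ^ (6 * N + d - 5)) atTop (𝓝 0) := by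
      have := (tendsto_pow_atTop_nhds_zero_of_lt_one (r := (1 / 3 : ℝ)) (by norm_num)
        (by norm_num)).comp
        (tendsto_atTop_mono (fun N ↦ (by lia : N ≤ 6 * N + d - 5 + 4)) tendsto_id)
      have := this.const_mul (1 / 15 * 3 ^ 4)
      rw [mul_zero] at this
      refine this.congr fun N ↦ ?_
      simp only [Function.comp_apply, pow_add]
      ring
    refine squeeze_zero_norm' ?_ hlim
    filter_upwards [eventually_ge_atTop 1] with N hN
    exact norm_E_sub_le _ (by ring) (by lia) hz.one_le_norm hz.abs_re_le
  have := (herr.add (hpow hz.one_lt_norm_add_one)).add (hpow hz.one_lt_norm_sub_one)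
  simp only [add_zero] at this
  refine this.congr fun N ↦ ?_
  rw [pow_add (z : ℂ) (12 * N), pow_mul, mul_inv, inv_pow]
  ring

open Filter Topology in
theorem not_forall_E_eq_zero {z : ℍ} (hz : IsGeneric z) {c : ℕ} (hc : Even c) (hc3 : 3 ≤ c) :
    ¬ ∀ N : ℕ, ModularForm.E (show 3 ≤ 12 * N + c by lia) z = 0 := by
  intro h
  have := coeff_eq_zero_of_tendsto_geometric (c₁ := -1) (c₂ := -((z : ℂ) ^ c)⁻¹) (c₃ := 0) (c₄ := 0)
    (r₁ := 1) (r₂ := ((z : ℂ) ^ 12)⁻¹) (r₃ := 0) (r₄ := 0) (by simp) hz.inv_pow_ne_one (by simp)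
    (by simp) ((hz.tendsto_E_sub hc hc3).congr fun N ↦ by simp [h]; ring)
  simp at this

/-- `E₄(z)` divides all the `E_{12 N + 4}(z)`, which do not all vanish. -/
theorem E₄_ne_zero {z : ℍ} (hz : IsGeneric z) : ModularForm.E₄ z ≠ 0 := by
  intro h0
  refine hz.not_forall_E_eq_zero (c := 4) ⟨2, rfl⟩ (by norm_num) fun N ↦ ?_
  obtain ⟨P, -, -, hP⟩ := exists_polynomial_jFun (a := 1) (b := 0) (by norm_num) (by norm_num) N
    (by push_cast; ring) (ModularForm.E (show 3 ≤ 12 * N + 4 by lia))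
  simp [hP, h0]

theorem E₆_ne_zero {z : ℍ} (hz : IsGeneric z) : ModularForm.E₆ z ≠ 0 := by
  intro h0
  refine hz.not_forall_E_eq_zero (c := 6) ⟨3, rfl⟩ (by norm_num) fun N ↦ ?_
  obtain ⟨P, -, -, hP⟩ := exists_polynomial_jFun (a := 0) (b := 1) (by norm_num) (by norm_num) N
    (by push_cast; ring) (ModularForm.E (show 3 ≤ 12 * N + 6 by lia))
  simp [hP, h0]

open Filter Topology ModularForm in
/-- If `j z = j w`, then `E_{12 N + 4}` takes values at `z` and `w` whose ratio is a geometric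
sequence in `N`; comparison of the main terms `1 + z⁻ᵏ` and `1 + w⁻ᵏ` leaves only two
possibilities. -/
theorem pow_eq_or_mul_pow_eq_one {z w : ℍ} (hz : IsGeneric z) (hw : IsGeneric w)
    (hn : ‖(z : ℂ)‖ = 1 ∨ ‖(w : ℂ)‖ = 1) (hj : jFun z = jFun w) :
    (z : ℂ) ^ 12 = (w : ℂ) ^ 12 ∨ ((z : ℂ) * w) ^ 4 = 1 := by
  -- The ratio of the geometric sequence is `Δ w / Δ z`; being bounded by one, it preserves `o(1)`.
  wlog hΔ : ‖discriminant w‖ ≤ ‖discriminant z‖ generalizing z w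
  · rw [mul_comm, eq_comm]
    exact this hw hz hn.symm hj.symm (le_of_not_ge hΔ)
  have hz0 : (z : ℂ) ≠ 0 := ne_zero z
  have hw0 : (w : ℂ) ≠ 0 := ne_zero w
  have hx : ‖discriminant w / discriminant z‖ ≤ 1 := by
    rw [norm_div]
    exact div_le_one_of_le₀ hΔ (norm_nonneg _)
  have hE (N : ℕ) : E (show 3 ≤ 12 * N + 4 by lia) w =
      (discriminant w / discriminant z) ^ N *
        (E₄ w / E₄ z * E (show 3 ≤ 12 * N + 4 by lia) z) := by
    obtain ⟨P, -, -, hP⟩ := exists_polynomial_jFun (a := 1) (b := 0) (by norm_num) (by norm_num) N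
      (by push_cast; ring) (E (show 3 ≤ 12 * N + 4 by lia))
    have h4 := hz.E₄_ne_zero
    have hd := discriminant_ne_zero z
    rw [hP, hP, hj, div_pow]
    field_simp
  have hlim := hw.tendsto_E_sub (c := 4) ⟨2, rfl⟩ (by norm_num)
  have hlim' := (hz.tendsto_E_sub (c := 4) ⟨2, rfl⟩ (by norm_num)).const_mul (E₄ w / E₄ z)
  have hprod : Tendsto (fun N : ℕ ↦ (discriminant w / discriminant z) ^ N *
      (E₄ w / E₄ z * (E (show 3 ≤ 12 * N + 4 by lia) z -
        (1 + ((z : ℂ) ^ 4)⁻¹ * ((z : ℂ) ^ 12)⁻¹ ^ N)))) atTop (𝓝 0) := by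
    rw [mul_zero] at hlim'
    refine squeeze_zero_norm (fun N ↦ ?_) (tendsto_zero_iff_norm_tendsto_zero.mp hlim')
    rw [norm_mul, norm_pow]
    exact mul_le_of_le_one_left (norm_nonneg _) (pow_le_one₀ (norm_nonneg _) hx)
  have hsub := hprod.sub hlim
  rw [sub_zero] at hsub
  rcases eq_or_mul_eq_one_of_tendsto_geometric (u := ((z : ℂ) ^ 12)⁻¹) (v := ((w : ℂ) ^ 12)⁻¹)
    (a := ((z : ℂ) ^ 4)⁻¹) (b := ((w : ℂ) ^ 4)⁻¹) (y := E₄ w / E₄ z)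
    (by simpa using hz0) (by simpa using hw0) (div_ne_zero hw.E₄_ne_zero hz.E₄_ne_zero)
    hz.inv_pow_ne_one hw.inv_pow_ne_one hz.norm_inv_pow_le_one hx
    (by rcases hn with h | h <;> simp [h]) (hsub.congr fun N ↦ by rw [hE]; ring) with h | ⟨-, h⟩
  · exact .inl (inv_injective h)
  · right
    rw [← mul_inv, inv_eq_one, ← mul_pow] at h
    exact h

end IsGeneric

/-! ### Eisenstein series on the unit circle -/

/-- The point `exp(iθ)` of the unit circle, as a point of the upper half plane; the value is junk
unless `0 < sin θ`. -/
noncomputable def arcPoint (θ : ℝ) : ℍ := ofComplex (Complex.exp (θ * Complex.I))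

lemma coe_arcPoint {θ : ℝ} (h0 : 0 < θ) (hπ : θ < Real.pi) :
    (arcPoint θ : ℂ) = Complex.exp (θ * Complex.I) := by
  rw [arcPoint, ofComplex_apply_of_im_pos]
  rw [Complex.exp_ofReal_mul_I_im]
  exact Real.sin_pos_of_pos_of_lt_pi h0 hπ

lemma norm_arcPoint {θ : ℝ} (h0 : 0 < θ) (hπ : θ < Real.pi) : ‖(arcPoint θ : ℂ)‖ = 1 := by
  rw [coe_arcPoint h0 hπ, Complex.norm_exp_ofReal_mul_I]

lemma re_arcPoint {θ : ℝ} (h0 : 0 < θ) (hπ : θ < Real.pi) : (arcPoint θ).re = Real.cos θ := by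
  rw [← coe_re, coe_arcPoint h0 hπ, Complex.exp_ofReal_mul_I_re]

/-- The function `exp(ikθ/2) E_k(exp(iθ))`, which is real for `0 < θ < π` by `ofReal_arcE`; taking
the real part makes it a real function by definition. -/
noncomputable def arcE {k : ℕ} (hk : 3 ≤ k) (θ : ℝ) : ℝ :=
  (Complex.exp ((θ / 2 : ℝ) * Complex.I) ^ k * ModularForm.E hk (arcPoint θ)).re

lemma ofReal_arcE {k : ℕ} (hk : 3 ≤ k) {θ : ℝ} (h0 : 0 < θ) (hπ : θ < Real.pi) :
    (arcE hk θ : ℂ) =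
      Complex.exp ((θ / 2 : ℝ) * Complex.I) ^ k * ModularForm.E hk (arcPoint θ) := by
  rw [arcE, ← Complex.conj_eq_iff_re]
  have h1 : (Complex.exp ((θ / 2 : ℝ) * Complex.I)) ^ 2 = (arcPoint θ : ℂ) := by
    rw [coe_arcPoint h0 hπ, ← Complex.exp_nat_mul]
    congr 1
    push_cast
    ring
  have h2 : (starRingEnd ℂ) (Complex.exp ((θ / 2 : ℝ) * Complex.I)) *
      Complex.exp ((θ / 2 : ℝ) * Complex.I) = 1 := by
    rw [Complex.conj_mul', Complex.norm_exp_ofReal_mul_I]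
    simp
  rw [map_mul, map_pow, conj_E_eq hk (norm_arcPoint h0 hπ), ← h1, ← mul_assoc, ← mul_pow, pow_two,
    ← mul_assoc, h2, one_mul]

lemma continuousOn_arcE {k : ℕ} (hk : 3 ≤ k) : ContinuousOn (arcE hk) (Set.Ioo 0 Real.pi) := by
  have h : ContinuousOn arcPoint (Set.Ioo 0 Real.pi) := by
    intro θ hθ
    have := (mdifferentiableAt_ofComplex (z := Complex.exp (θ * Complex.I)) (by
      rw [Complex.exp_ofReal_mul_I_im]
      exact Real.sin_pos_of_pos_of_lt_pi hθ.1 hθ.2)).continuousAt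
    exact (ContinuousAt.comp (f := fun θ : ℝ ↦ Complex.exp (θ * Complex.I)) this
      (by fun_prop)).continuousWithinAt
  refine Complex.continuous_re.comp_continuousOn (ContinuousOn.mul (by fun_prop) ?_)
  exact (ModularFormClass.continuous (ModularForm.E hk)).comp_continuousOn h

/-- The first main term comes from `(c, d) = ±(0, 1), ±(1, 0)`, the second from `±(1, 1)`, which
has size `1` at `θ = 2π/3`. -/
theorem abs_arcE_sub_le {k : ℕ} (hk : 3 ≤ k) (hev : Even k) (hk10 : 10 ≤ k) {θ : ℝ}
    (h1 : Real.pi / 2 ≤ θ) (h2 : θ ≤ 2 * Real.pi / 3) :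
    |arcE hk θ - (2 * Real.cos (k * θ / 2) + ((2 * Real.cos (θ / 2)) ^ k)⁻¹)| ≤ 1 / 10 := by
  have hpi := Real.pi_pos
  have h0 : 0 < θ := by linarith
  have hπ : θ < Real.pi := by linarith
  obtain ⟨h, hkh⟩ := hev
  set q := Complex.exp ((θ / 2 : ℝ) * Complex.I) with hq
  have hq0 : q ≠ 0 := Complex.exp_ne_zero _
  have hqinv : q⁻¹ = Complex.exp (-((θ / 2 : ℝ) * Complex.I)) := (Complex.exp_neg _).symm
  have hqn : ‖q‖ = 1 := Complex.norm_exp_ofReal_mul_I _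
  have hz : (arcPoint θ : ℂ) = q * q := by
    rw [coe_arcPoint h0 hπ, hq, ← Complex.exp_add]
    congr 1
    push_cast
    ring
  have hc : q + q⁻¹ = 2 * Real.cos (θ / 2) := by
    rw [hqinv, Complex.ofReal_cos, Complex.two_cos, neg_mul]
  have hs : q - q⁻¹ = 2 * Real.sin (θ / 2) * Complex.I := by
    rw [hqinv, Complex.ofReal_sin, Complex.two_sin, neg_mul]
    linear_combination (-(Complex.exp (-((θ / 2 : ℝ) * Complex.I)) -
      Complex.exp ((θ / 2 : ℝ) * Complex.I))) * Complex.I_sq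
  have hck : q ^ k + (q ^ k)⁻¹ = 2 * Real.cos (k * θ / 2) := by
    rw [hq, ← Complex.exp_nat_mul, ← Complex.exp_neg, Complex.ofReal_cos, Complex.two_cos]
    push_cast
    congr 2 <;> ring
  have hre : |(arcPoint θ).re| ≤ 1 / 2 := by
    have ha : Real.cos θ ≤ 0 := Real.cos_nonpos_of_pi_div_two_le_of_le h1 (by linarith)
    have hb : Real.cos (2 * Real.pi / 3) ≤ Real.cos θ :=
      Real.cos_le_cos_of_nonneg_of_le_pi h0.le (by linarith) h2
    rw [show 2 * Real.pi / 3 = Real.pi - Real.pi / 3 by ring, Real.cos_pi_sub,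
      Real.cos_pi_div_three] at hb
    rw [re_arcPoint h0 hπ, abs_le]
    constructor <;> linarith
  have hE := norm_E_sub_le hk (show k = 2 * h by lia) (by lia) (norm_arcPoint h0 hπ).ge hre
  have hsin : (1 / 2 : ℝ) ≤ Real.sin (θ / 2) ^ 2 := by
    have ha : Real.cos θ ≤ 0 := Real.cos_nonpos_of_pi_div_two_le_of_le h1 (by linarith)
    rw [Real.sin_sq_eq_half_sub, show 2 * (θ / 2) = θ by ring]
    linarith
  have hS : ‖((q - q⁻¹) ^ k)⁻¹‖ ≤ 1 / 32 := by
    have hn : ‖q - q⁻¹‖ ^ 2 = 4 * Real.sin (θ / 2) ^ 2 := by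
      rw [hs]
      simp only [norm_mul, Complex.norm_I, Complex.norm_real, Complex.norm_ofNat, mul_one, mul_pow,
        Real.norm_eq_abs, sq_abs]
      norm_num
    have h2n : 2 ≤ ‖q - q⁻¹‖ ^ 2 := by rw [hn]; linarith
    rw [norm_inv, norm_pow, show k = 2 * h by lia, pow_mul,
      inv_le_comm₀ (by positivity) (by norm_num)]
    calc (1 / 32 : ℝ)⁻¹ = 2 ^ 5 := by norm_num
      _ ≤ 2 ^ h := pow_le_pow_right₀ (by norm_num) (by lia)
      _ ≤ _ := by gcongr
  have key : ((arcE hk θ - (2 * Real.cos (k * θ / 2) + ((2 * Real.cos (θ / 2)) ^ k)⁻¹) : ℝ) : ℂ) =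
      q ^ k * (ModularForm.E hk (arcPoint θ) - (1 + ((arcPoint θ : ℂ) ^ k)⁻¹ +
        (((arcPoint θ : ℂ) + 1) ^ k)⁻¹ + (((arcPoint θ : ℂ) - 1) ^ k)⁻¹)) + ((q - q⁻¹) ^ k)⁻¹ := by
    have e1 : (arcPoint θ : ℂ) + 1 = q * (q + q⁻¹) := by
      rw [hz, mul_add, mul_inv_cancel₀ hq0]
    have e2 : (arcPoint θ : ℂ) - 1 = q * (q - q⁻¹) := by
      rw [hz, mul_sub, mul_inv_cancel₀ hq0]
    rw [e1, e2, hz]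
    simp only [Complex.ofReal_sub, Complex.ofReal_add, Complex.ofReal_mul, Complex.ofReal_inv,
      Complex.ofReal_pow, Complex.ofReal_ofNat]
    rw [ofReal_arcE hk h0 hπ, ← hck, ← hc, ← hq]
    simp only [mul_pow, mul_inv]
    have : q ^ k * (q ^ k)⁻¹ = 1 := mul_inv_cancel₀ (pow_ne_zero _ hq0)
    linear_combination ((q ^ k)⁻¹ + ((q + q⁻¹) ^ k)⁻¹ + ((q - q⁻¹) ^ k)⁻¹) * this
  rw [← Real.norm_eq_abs, ← Complex.norm_real, key]
  refine (norm_add_le _ _).trans ?_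
  rw [norm_mul, norm_pow, hqn, one_pow, one_mul]
  have h3 : (1 / 3 : ℝ) ^ (h - 5) ≤ 1 := pow_le_one₀ (by norm_num) (by norm_num)
  linarith

/-! ### Signs on the arc -/

/-- If `θ = π m / H` is not the endpoint `2π/3`, then it is at least `π / (3 H)` below it, and
`2 cos (θ/2)` is large enough there for its `H`-th power to stay away from `1`. -/
lemma five_thirds_le_two_cos_pow {H m : ℕ} (hH : 11 ≤ H) (hm : 3 * m + 1 ≤ 2 * H) {θ : ℝ}
    (h0 : 0 ≤ θ) (hθ : H * θ = Real.pi * m) : 5 / 3 ≤ (2 * Real.cos (θ / 2)) ^ H := by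
  have hpi := Real.pi_gt_d4
  have hpi' := Real.pi_lt_d4
  have hHR : (11 : ℝ) ≤ H := by exact_mod_cast hH
  have hmR : 3 * (m : ℝ) + 1 ≤ 2 * H := by exact_mod_cast hm
  set x : ℝ := Real.pi / (6 * H) with hx
  have hHx : H * x = Real.pi / 6 := by rw [hx]; field_simp
  have hx0 : 0 < x := by positivity
  have hx1 : x ≤ 1 / 20 := by nlinarith
  have hle : θ / 2 ≤ Real.pi / 3 - x := by
    have : (H : ℝ) * (θ / 2) ≤ H * (Real.pi / 3 - x) := by
      rw [mul_sub, hHx]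
      nlinarith
    exact le_of_mul_le_mul_left this (by linarith)
  have hcos : Real.cos (Real.pi / 3 - x) ≤ Real.cos (θ / 2) :=
    Real.cos_le_cos_of_nonneg_of_le_pi (by linarith) (by linarith) hle
  rw [Real.cos_sub, Real.cos_pi_div_three, Real.sin_pi_div_three] at hcos
  have hs3 : (1.73 : ℝ) ≤ √3 := Real.le_sqrt_of_sq_le (by norm_num)
  have hsin := Real.sin_gt_sub_cube hx0
  have hc := Real.one_sub_sq_div_two_le_cos (x := x)
  have hsin' : 0.999 * x ≤ Real.sin x := by nlinarith [mul_pos hx0 hx0]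
  have hlow : 1 + 1.7 * x ≤ 2 * Real.cos (θ / 2) := by
    have : 1.73 * (0.999 * x) ≤ √3 * Real.sin x := by gcongr
    nlinarith
  calc (5 / 3 : ℝ) ≤ 1 + H * (1.7 * x) := by
        rw [mul_left_comm, hHx]
        linarith
    _ ≤ (1 + 1.7 * x) ^ H := one_add_mul_le_pow (by linarith) H
    _ ≤ _ := by gcongr

/-- The approximations come from `abs_arcE_sub_le`. Up to errors,
`X Y + Z = (2 C + (A + B) / 2)² - (A - B)² / 4 + 2 + A B`. -/
lemma pos_of_approx_even {C A B X Y Z : ℝ} (hC : |C| ≤ 1) (hA : 0 ≤ A) (hA1 : A ≤ 1)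
    (hB : 0 ≤ B) (hB1 : B ≤ 1) (hX : |X - (2 * C + B)| ≤ 1 / 10) (hY : |Y - (2 * C + A)| ≤ 1 / 10)
    (hZ : |Z - (2 + A * B)| ≤ 1 / 10) : 0 < X * Y + Z := by
  obtain ⟨hC1, hC2⟩ := abs_le.mp hC
  have e1 : |(X - (2 * C + B)) * (2 * C + A)| ≤ 1 / 10 * 3 := by
    rw [abs_mul]
    exact mul_le_mul hX (abs_le.mpr ⟨by linarith, by linarith⟩) (abs_nonneg _) (by norm_num)
  have e2 : |(Y - (2 * C + A)) * (2 * C + B)| ≤ 1 / 10 * 3 := by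
    rw [abs_mul]
    exact mul_le_mul hY (abs_le.mpr ⟨by linarith, by linarith⟩) (abs_nonneg _) (by norm_num)
  have e3 : |(X - (2 * C + B)) * (Y - (2 * C + A))| ≤ 1 / 10 * (1 / 10) := by
    rw [abs_mul]
    exact mul_le_mul hX hY (abs_nonneg _) (by norm_num)
  have := (abs_le.mp e1).1
  have := (abs_le.mp e2).1
  have := (abs_le.mp e3).1
  have := (abs_le.mp hZ).1
  have h4 : (A - B) ^ 2 ≤ 1 := by nlinarith
  nlinarith [sq_nonneg (2 * C + (A + B) / 2), mul_nonneg hA hB]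

/-- The analogue of `pos_of_approx_even` for the other sign; up to errors,
`-(X Y + Z) = (2 C + (A - B) / 2)² - (A + B)² / 4 + 2 - A B`, which could vanish at
`A = B = 1`. -/
lemma neg_of_approx_odd {C A B X Y Z : ℝ} (hC : |C| ≤ 1) (hA : 0 ≤ A) (hA1 : A ≤ 1)
    (hB : 0 ≤ B) (hB1 : B ≤ 3 / 5) (hX : |X - (-(2 * C) + B)| ≤ 1 / 10)
    (hY : |Y - (2 * C + A)| ≤ 1 / 10) (hZ : |Z - (-2 + A * B)| ≤ 1 / 10) : X * Y + Z < 0 := by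
  obtain ⟨hC1, hC2⟩ := abs_le.mp hC
  have e1 : |(X - (-(2 * C) + B)) * (2 * C + A)| ≤ 1 / 10 * 3 := by
    rw [abs_mul]
    exact mul_le_mul hX (abs_le.mpr ⟨by linarith, by linarith⟩) (abs_nonneg _) (by norm_num)
  have e2 : |(Y - (2 * C + A)) * (-(2 * C) + B)| ≤ 1 / 10 * 3 := by
    rw [abs_mul]
    exact mul_le_mul hY (abs_le.mpr ⟨by linarith, by linarith⟩) (abs_nonneg _) (by norm_num)
  have e3 : |(X - (-(2 * C) + B)) * (Y - (2 * C + A))| ≤ 1 / 10 * (1 / 10) := by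
    rw [abs_mul]
    exact mul_le_mul hX hY (abs_nonneg _) (by norm_num)
  have := (abs_le.mp e1).2
  have := (abs_le.mp e2).2
  have := (abs_le.mp e3).2
  have := (abs_le.mp hZ).2
  have h4 : (A + B) ^ 2 ≤ (8 / 5) ^ 2 := by gcongr; linarith
  have h5 : A * B ≤ 1 * (3 / 5) := by gcongr
  nlinarith [sq_nonneg (2 * C + (A - B) / 2)]

/-- At the points where `cos ((k + l) θ / 2) = ±1`, the function
`exp(i (k + l) θ / 2) (E_k E_l + E_{k+l})` has the sign of this cosine. -/
theorem sign_arcE {k l : ℕ} (hk : Even k) (hl : Even l) (hl10 : 10 ≤ l) (hlk : l < k) {H m : ℕ}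
    (hH : k + l = 2 * H) {θ : ℝ} (h1 : Real.pi / 2 ≤ θ) (h2 : θ ≤ 2 * Real.pi / 3)
    (hθ : H * θ = Real.pi * m) :
    0 < (-1) ^ m * (arcE (show 3 ≤ k by lia) θ * arcE (show 3 ≤ l by lia) θ +
      arcE (show 3 ≤ k + l by lia) θ) := by
  have hpi := Real.pi_pos
  have hX := abs_arcE_sub_le (show 3 ≤ k by lia) hk (by lia) h1 h2
  have hY := abs_arcE_sub_le (show 3 ≤ l by lia) hl (by lia) h1 h2
  have hZ := abs_arcE_sub_le (show 3 ≤ k + l by lia) (hk.add hl) (by lia) h1 h2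
  have hsumR : (k : ℝ) + l = 2 * H := by exact_mod_cast hH
  have hcosm : Real.cos (m * Real.pi) = (-1) ^ m := Real.cos_nat_mul_pi m
  rw [show ((k + l : ℕ) : ℝ) * θ / 2 = m * Real.pi by
    push_cast; rw [hsumR]; linear_combination hθ, hcosm] at hZ
  rw [show (k : ℝ) * θ / 2 = m * Real.pi - l * θ / 2 by
    linear_combination hθ + θ / 2 * hsumR, Real.cos_nat_mul_pi_sub] at hX
  set r := 2 * Real.cos (θ / 2) with hr
  have hr1 : 1 ≤ r := by
    have := Real.cos_le_cos_of_nonneg_of_le_pi (by linarith : 0 ≤ θ / 2)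
      (by linarith : Real.pi / 3 ≤ Real.pi) (by linarith)
    rw [Real.cos_pi_div_three] at this
    linarith
  have hinv (n : ℕ) : 0 ≤ (r ^ n)⁻¹ ∧ (r ^ n)⁻¹ ≤ 1 :=
    ⟨by positivity, inv_le_one_of_one_le₀ (one_le_pow₀ hr1)⟩
  rw [pow_add, mul_inv, mul_comm (r ^ k)⁻¹] at hZ
  rcases Nat.even_or_odd m with hm | hm
  · rw [hm.neg_one_pow] at hX hZ ⊢
    rw [one_mul]
    exact pos_of_approx_even (Real.abs_cos_le_one _) (hinv l).1 (hinv l).2 (hinv k).1 (hinv k).2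
      (by simpa using hX) hY (by simpa using hZ)
  · rw [hm.neg_one_pow] at hX hZ ⊢
    -- As `m` is odd, `θ = 2π/3` is excluded here, so `3 m + 1 ≤ 2 H`.
    have h3m : 3 * m ≤ 2 * H := by
      have : Real.pi * (3 * m) ≤ Real.pi * (2 * H) := by nlinarith
      exact_mod_cast le_of_mul_le_mul_left this hpi
    have hrH := five_thirds_le_two_cos_pow (by lia) (by obtain ⟨j, rfl⟩ := hm; lia)
      (by linarith) hθ
    have hB : (r ^ k)⁻¹ ≤ 3 / 5 := by
      rw [inv_le_comm₀ (by positivity) (by norm_num)]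
      calc ((3 / 5 : ℝ))⁻¹ = 5 / 3 := by norm_num
        _ ≤ r ^ H := hrH
        _ ≤ r ^ k := pow_le_pow_right₀ hr1 (by lia)
    have := neg_of_approx_odd (Real.abs_cos_le_one _) (hinv l).1 (hinv l).2 (hinv k).1 hB
      (by simpa using hX) hY (by simpa using hZ)
    linarith

/-! ### Points of the fundamental domain and their `j`-values -/

lemma norm_add_one_sq_and_norm_sub_one_sq (z : ℍ) :
    ‖(z : ℂ) + 1‖ ^ 2 = ‖(z : ℂ)‖ ^ 2 + 2 * z.re + 1 ∧
      ‖(z : ℂ) - 1‖ ^ 2 = ‖(z : ℂ)‖ ^ 2 - 2 * z.re + 1 := by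
  simp only [Complex.sq_norm, Complex.normSq_apply]
  constructor <;> simp <;> ring

lemma isGeneric_of_one_lt_norm {z : ℍ} (hz : 1 < ‖(z : ℂ)‖) (hre : |z.re| ≤ 1 / 2) :
    IsGeneric z := by
  obtain ⟨h1, h2⟩ := norm_add_one_sq_and_norm_sub_one_sq z
  obtain ⟨h3, h4⟩ := abs_le.mp hre
  refine ⟨hz.le, hre, ?_, ?_, fun h ↦ ?_⟩
  · nlinarith [norm_nonneg ((z : ℂ) + 1)]
  · nlinarith [norm_nonneg ((z : ℂ) - 1)]
  · have := one_lt_pow₀ hz (n := 12) (by norm_num)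
    rw [← norm_pow, h, norm_one] at this
    exact this.false

lemma isGeneric_arcPoint {θ : ℝ} (h1 : Real.pi / 2 < θ) (h2 : θ < 2 * Real.pi / 3) :
    IsGeneric (arcPoint θ) := by
  have hpi := Real.pi_pos
  have h0 : 0 < θ := by linarith
  have hπ : θ < Real.pi := by linarith
  have hn := norm_arcPoint h0 hπ
  have ha : Real.cos θ ≤ 0 := Real.cos_nonpos_of_pi_div_two_le_of_le h1.le (by linarith)
  have hb : Real.cos (2 * Real.pi / 3) < Real.cos θ :=
    Real.cos_lt_cos_of_nonneg_of_le_pi h0.le (by linarith) h2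
  rw [show 2 * Real.pi / 3 = Real.pi - Real.pi / 3 by ring, Real.cos_pi_sub,
    Real.cos_pi_div_three] at hb
  obtain ⟨h3, h4⟩ := norm_add_one_sq_and_norm_sub_one_sq (arcPoint θ)
  rw [re_arcPoint h0 hπ, hn] at h3 h4
  refine ⟨hn.ge, ?_, ?_, ?_, fun h ↦ ?_⟩
  · rw [re_arcPoint h0 hπ, abs_le]
    constructor <;> linarith
  · nlinarith [norm_nonneg ((arcPoint θ : ℂ) + 1)]
  · nlinarith [norm_nonneg ((arcPoint θ : ℂ) - 1)]
  · rw [coe_arcPoint h0 hπ, ← Complex.exp_nat_mul, Complex.exp_eq_one_iff] at h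
    obtain ⟨n, hn⟩ := h
    have h5 : 12 * θ = n * (2 * Real.pi) := by
      have := congrArg Complex.im hn
      simpa using this
    have h6 : (3 : ℝ) < n := by nlinarith
    have h7 : (n : ℝ) < 4 := by nlinarith
    norm_cast at h6 h7
    lia

lemma injOn_jFun_arcPoint :
    Set.InjOn (fun θ ↦ jFun (arcPoint θ)) (Set.Ioo (Real.pi / 2) (2 * Real.pi / 3)) := by
  intro s hs t ht hst
  have hpi := Real.pi_pos
  obtain ⟨hs1, hs2⟩ := hs
  obtain ⟨ht1, ht2⟩ := ht
  have hs0 : 0 < s := by linarith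
  have hsπ : s < Real.pi := by linarith
  have ht0 : 0 < t := by linarith
  have htπ : t < Real.pi := by linarith
  rcases (isGeneric_arcPoint hs1 hs2).pow_eq_or_mul_pow_eq_one (isGeneric_arcPoint ht1 ht2)
    (.inl (norm_arcPoint hs0 hsπ)) hst with h | h
  · rw [coe_arcPoint hs0 hsπ, coe_arcPoint ht0 htπ, ← Complex.exp_nat_mul, ← Complex.exp_nat_mul,
      Complex.exp_eq_exp_iff_exists_int] at h
    obtain ⟨n, hn⟩ := h
    have h5 : 12 * s = 12 * t + n * (2 * Real.pi) := by
      have := congrArg Complex.im hn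
      simpa using this
    have h6 : (-1 : ℝ) < n := by nlinarith
    have h7 : (n : ℝ) < 1 := by nlinarith
    norm_cast at h6 h7
    obtain rfl : n = 0 := by lia
    simp at h5
    exact h5
  · rw [coe_arcPoint hs0 hsπ, coe_arcPoint ht0 htπ, ← Complex.exp_add, ← Complex.exp_nat_mul,
      Complex.exp_eq_one_iff] at h
    obtain ⟨n, hn⟩ := h
    -- `s + t` would be a multiple of `π / 2` strictly between `π` and `4π/3`.
    have h5 : 4 * (s + t) = n * (2 * Real.pi) := by
      have := congrArg Complex.im hn
      simpa using this
    have h6 : (2 : ℝ) < n := by nlinarith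
    have h7 : (n : ℝ) < 3 := by nlinarith
    norm_cast at h6 h7
    lia

/-- `j` takes no value of the open arc in the part `|z| > 1` of the fundamental domain. -/
lemma jFun_arcPoint_ne {θ : ℝ} (h1 : Real.pi / 2 < θ) (h2 : θ < 2 * Real.pi / 3) {z : ℍ}
    (hz : 1 < ‖(z : ℂ)‖) (hre : |z.re| ≤ 1 / 2) : jFun (arcPoint θ) ≠ jFun z := by
  intro hj
  have hpi := Real.pi_pos
  have hn := norm_arcPoint (θ := θ) (by linarith) (by linarith)
  rcases (isGeneric_arcPoint h1 h2).pow_eq_or_mul_pow_eq_one (isGeneric_of_one_lt_norm hz hre)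
    (.inl hn) hj with h | h
  · have := one_lt_pow₀ hz (n := 12) (by norm_num)
    rw [← norm_pow, ← h, norm_pow, hn, one_pow] at this
    exact this.false
  · have := one_lt_pow₀ hz (n := 4) (by norm_num)
    rw [mul_pow] at h
    have h' := congrArg norm h
    rw [norm_mul, norm_pow, norm_pow, hn, one_pow, one_mul, norm_one] at h'
    exact this.ne' h'

lemma mem_lowerArc_or_one_lt_norm {z : ℍ} (hz : z ∈ stdFundamentalDomain) :
    (z : ℂ) ∈ lowerArc ∨ (1 < ‖(z : ℂ)‖ ∧ |z.re| ≤ 1 / 2) := by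
  rcases hz with ⟨h1, h2, h3⟩ | ⟨h1, h2, h3⟩
  · exact .inr ⟨h1, abs_le.mpr ⟨by linarith, h3.le⟩⟩
  · rcases h1.lt_or_eq with h | h
    · exact .inr ⟨h, abs_le.mpr ⟨h2, by linarith⟩⟩
    · left
      have hpi := Real.pi_pos
      have hpolar : Complex.exp (Complex.I * Complex.arg z) = z := by
        have := Complex.norm_mul_exp_arg_mul_I (z : ℂ)
        rwa [← h, Complex.ofReal_one, one_mul, mul_comm] at this
      have hcos : Real.cos (Complex.arg z) = z.re := by
        rw [← coe_re, ← hpolar, mul_comm, Complex.exp_ofReal_mul_I_re, mul_comm, hpolar]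
      have h0 : 0 ≤ Complex.arg z := Complex.arg_nonneg_iff.mpr z.im_pos.le
      refine ⟨Complex.arg z, ?_, ?_, hpolar.symm⟩
      · by_contra! hlt
        have := Real.cos_pos_of_mem_Ioo ⟨by linarith, hlt⟩
        linarith
      · by_contra! hlt
        have := Real.cos_lt_cos_of_nonneg_of_le_pi (by linarith) (Complex.arg_le_pi z) hlt
        rw [show 2 * Real.pi / 3 = Real.pi - Real.pi / 3 by ring, Real.cos_pi_sub,
          Real.cos_pi_div_three] at this
        linarith

/-! ### Counting zeros -/

lemma exists_injective_zeros_of_alternating {F : ℝ → ℝ} {a b : ℝ}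
    (hF : ContinuousOn F (Set.Icc a b)) {n : ℕ}
    {x : ℕ → ℝ} (hx : ∀ i < n, x i < x (i + 1)) (hxa : a ≤ x 0) (hxb : x n ≤ b) {m : ℕ}
    (hsign : ∀ i ≤ n, 0 < (-1) ^ (m + i) * F (x i)) :
    ∃ t : Fin n → ℝ, Function.Injective t ∧ ∀ i, t i ∈ Set.Ioo a b ∧ F (t i) = 0 := by
  have hmono {i j : ℕ} (hij : i ≤ j) (hj : j ≤ n) : x i ≤ x j := by
    induction j, hij using Nat.le_induction with
    | base => exact le_rfl
    | succ j hij ih => exact (ih (by lia)).trans (hx j (by lia)).le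
  have hex (i : Fin n) : ∃ t ∈ Set.Ioo (x i) (x (i + 1)), F t = 0 := by
    have hi := i.2
    have hsub : Set.Icc (x i) (x (i + 1)) ⊆ Set.Icc a b :=
      Set.Icc_subset_Icc (hxa.trans (hmono (Nat.zero_le _) hi.le))
        ((hmono (by lia) le_rfl).trans hxb)
    have hc : ContinuousOn (fun t ↦ (-1) ^ (m + i + 1) * F t) (Set.Icc (x i) (x (i + 1))) :=
      (hF.mono hsub).const_mul _
    have h1 := hsign i hi.le
    have h2 := hsign (i + 1) hi
    obtain ⟨t, ht, h0⟩ := intermediate_value_Ioo (hx i hi).le hc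
      (show (0 : ℝ) ∈ Set.Ioo _ _ from ⟨by rw [pow_succ]; linarith, h2⟩)
    exact ⟨t, ht, by simpa using h0⟩
  choose t ht h0 using hex
  refine ⟨t, StrictMono.injective fun i j hij ↦ ?_, fun i ↦ ⟨⟨?_, ?_⟩, h0 i⟩⟩
  · exact (ht i).2.trans_le ((hmono (by exact hij) j.2.le).trans (ht j).1.le)
  · exact (hxa.trans (hmono (Nat.zero_le _) i.2.le)).trans_lt (ht i).1
  · exact (ht i).2.trans_le ((hmono i.2 le_rfl).trans hxb)

/-- The `n + 1` points `θ = 2π m / (k + l)` with `3 n + a + 2 b ≤ m ≤ 4 n + a + 2 b` lie in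
`[π/2, 2π/3]`. -/
theorem exists_zeros_on_arc {k l : ℕ} (hk : Even k) (hl : Even l) (hl10 : 10 ≤ l) (hlk : l < k)
    {n a b : ℕ} (hw : k + l = 12 * n + 4 * a + 6 * b) :
    ∃ t : Fin n → ℝ, Function.Injective t ∧ ∀ i, t i ∈ Set.Ioo (Real.pi / 2) (2 * Real.pi / 3) ∧
      ModularForm.E (show 3 ≤ k by lia) (arcPoint (t i)) *
        ModularForm.E (show 3 ≤ l by lia) (arcPoint (t i)) +
        ModularForm.E (show 3 ≤ k + l by lia) (arcPoint (t i)) = 0 := by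
  have hpi := Real.pi_pos
  set H := 6 * n + 2 * a + 3 * b with hH
  have hHpos : (0 : ℝ) < H := by exact_mod_cast (by lia : 0 < H)
  have hHR : (H : ℝ) = 6 * n + 2 * a + 3 * b := by rw [hH]; push_cast; ring
  let F : ℝ → ℝ := fun θ ↦ arcE (show 3 ≤ k by lia) θ * arcE (show 3 ≤ l by lia) θ +
    arcE (show 3 ≤ k + l by lia) θ
  let x : ℕ → ℝ := fun i ↦ Real.pi * (3 * n + a + 2 * b + i : ℕ) / H
  have hF : ContinuousOn F (Set.Icc (Real.pi / 2) (2 * Real.pi / 3)) :=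
    (((continuousOn_arcE _).mul (continuousOn_arcE _)).add (continuousOn_arcE _)).mono
      fun θ hθ ↦ ⟨by linarith [hθ.1], by linarith [hθ.2]⟩
  have hxlt (i j : ℕ) (hij : i < j) : x i < x j := by
    simp only [x]
    gcongr
  have hx0 : Real.pi / 2 ≤ x 0 := by
    simp only [x]
    rw [le_div_iff₀ hHpos, hHR]
    push_cast
    nlinarith [(Nat.cast_nonneg b : (0 : ℝ) ≤ b)]
  have hxn : x n ≤ 2 * Real.pi / 3 := by
    simp only [x]
    rw [div_le_iff₀ hHpos, hHR]
    push_cast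
    nlinarith [(Nat.cast_nonneg a : (0 : ℝ) ≤ a)]
  obtain ⟨t, htinj, ht⟩ := exists_injective_zeros_of_alternating hF (n := n) (x := x)
    (fun i _ ↦ hxlt i (i + 1) i.lt_succ_self) hx0 hxn (m := 3 * n + a + 2 * b) (fun i hi ↦ by
      refine sign_arcE hk hl hl10 hlk (H := H) (by lia) ?_ ?_ ?_
      · rcases i.eq_zero_or_pos with rfl | h
        exacts [hx0, hx0.trans (hxlt 0 i h).le]
      · rcases hi.eq_or_lt with rfl | h
        exacts [hxn, (hxlt i n h).le.trans hxn]
      · simp only [x]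
        field_simp)
  refine ⟨t, htinj, fun i ↦ ⟨(ht i).1, ?_⟩⟩
  have h0 : 0 < t i := by linarith [(ht i).1.1]
  have hπ : t i < Real.pi := by linarith [(ht i).1.2]
  have h := congrArg (fun r : ℝ ↦ (r : ℂ)) (ht i).2
  simp only [F, Complex.ofReal_add, Complex.ofReal_mul, Complex.ofReal_zero] at h
  rw [ofReal_arcE _ h0 hπ, ofReal_arcE _ h0 hπ, ofReal_arcE _ h0 hπ, pow_add] at h
  have hq : Complex.exp ((t i / 2 : ℝ) * Complex.I) ^ k *
      Complex.exp ((t i / 2 : ℝ) * Complex.I) ^ l ≠ 0 :=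
    mul_ne_zero (pow_ne_zero _ (Complex.exp_ne_zero _)) (pow_ne_zero _ (Complex.exp_ne_zero _))
  refine (mul_eq_zero.mp ?_).resolve_left hq
  linear_combination h

open ModularForm EisensteinSeries MatrixGroups in
lemma exists_modularForm_E_mul_E_add_E {k l : ℕ} (hk : 3 ≤ k) (hl : 3 ≤ l) (hkl : 3 ≤ k + l)
    (hke : Even k) (hle : Even l) :
    ∃ f : ModularForm 𝒮ℒ (k + l : ℤ), (∀ z, f z = E hk z * E hl z + E hkl z) ∧
      (qExpansion 1 f).coeff 0 = 2 := by
  refine ⟨(E hk).mul (E hl) + ModularForm.mcast (by push_cast; ring) (E hkl), fun z ↦ rfl, ?_⟩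
  have h1 := E_qExpansion_coeff_zero hk hke
  have h2 := E_qExpansion_coeff_zero hl hle
  have h3 := E_qExpansion_coeff_zero hkl (hke.add hle)
  rw [FunLike.coe_add, ModularForm.qExpansion_add one_pos one_mem_strictPeriods_SL,
    ModularForm.qExpansion_mcast, ModularForm.qExpansion_mul one_pos one_mem_strictPeriods_SL]
  simp only [PowerSeries.coeff_zero_eq_constantCoeff, map_mul, map_add] at *
  rw [h1, h2, h3]
  norm_num

theorem theorem2 (k l : ℕ) (hk : Even k) (hl : Even l) (hl10 : 10 ≤ l) (hlk : l < k)
    (τ : ℍ) (hτ : τ ∈ stdFundamentalDomain)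
    (hzero : ModularForm.E (show 3 ≤ k by omega) τ * ModularForm.E (show 3 ≤ l by omega) τ
      + ModularForm.E (show 3 ≤ k + l by omega) τ = 0) :
    (τ : ℂ) ∈ lowerArc := by
  rcases mem_lowerArc_or_one_lt_norm hτ with h | ⟨hnorm, hre⟩
  · exact h
  exfalso
  obtain ⟨n, a, b, ha, hb, hw⟩ :
      ∃ n a b : ℕ, a ≤ 2 ∧ b ≤ 1 ∧ k + l = 12 * n + 4 * a + 6 * b := by
    obtain ⟨w, hw⟩ := hk.add hl
    have h6 : w % 6 < 6 := Nat.mod_lt _ (by norm_num)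
    have hdiv := Nat.div_add_mod w 6
    interval_cases hr : w % 6
    · exact ⟨w / 6, 0, 0, by norm_num, by norm_num, by omega⟩
    · exact ⟨w / 6 - 1, 2, 1, by norm_num, by norm_num, by omega⟩
    · exact ⟨w / 6, 1, 0, by norm_num, by norm_num, by omega⟩
    · exact ⟨w / 6, 0, 1, by norm_num, by norm_num, by omega⟩
    · exact ⟨w / 6, 2, 0, by norm_num, by norm_num, by omega⟩
    · exact ⟨w / 6, 1, 1, by norm_num, by norm_num, by omega⟩
  obtain ⟨f, hf, hf0⟩ := exists_modularForm_E_mul_E_add_E (show 3 ≤ k by lia) (show 3 ≤ l by lia)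
    (by lia) hk hl
  obtain ⟨P, hdeg, hlead, hP⟩ := exists_polynomial_jFun ha hb n (by exact_mod_cast hw) f
  obtain ⟨t, htinj, ht⟩ := exists_zeros_on_arc hk hl hl10 hlk hw
  have hroot {z : ℍ} (hz : IsGeneric z) (hfz : f z = 0) : P.eval (jFun z) = 0 := by
    rw [hP] at hfz
    simpa [hz.E₄_ne_zero, hz.E₆_ne_zero, ModularForm.discriminant_ne_zero] using hfz
  -- `P` has degree at most `n`, but `n` roots from the open arc and one more from `τ`.
  have hP0 : P = 0 := by
    refine Polynomial.eq_zero_of_natDegree_lt_card_of_eval_eq_zero P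
      (f := fun o : Option (Fin n) ↦ o.elim (jFun τ) fun i ↦ jFun (arcPoint (t i))) ?_ ?_ ?_
    · rintro (_ | i) (_ | j) hij
      · rfl
      · exact (jFun_arcPoint_ne (ht j).1.1 (ht j).1.2 hnorm hre hij.symm).elim
      · exact (jFun_arcPoint_ne (ht i).1.1 (ht i).1.2 hnorm hre hij).elim
      · rw [htinj (injOn_jFun_arcPoint (ht i).1 (ht j).1 hij)]
    · rintro (_ | i)
      · exact hroot (isGeneric_of_one_lt_norm hnorm hre) ((hf τ).trans hzero)
      · exact hroot (isGeneric_arcPoint (ht i).1.1 (ht i).1.2) ((hf _).trans (ht i).2)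
    · simpa using Nat.lt_succ_of_le hdeg
  rw [hP0, Polynomial.coeff_zero, hf0] at hlead
  norm_num at hlead
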